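/- Let $r$ be a real number and let $(E_i)_{i\in I}$ be finite-dimensional real normed spaces, where $E_i$ is the space of values of the observation $Y_i$ of party $i$ (for instance $E_i=\mathbb{C}$ for a single server, or $E_i=\mathbb{C}^t$ for a coalition of $t$ servers). For each $i$ let the conditional law $P_{Y_i|S=s}$ of $Y_i$ given the secret $S=s$ be a Markov kernel from $\mathbb{R}$ to $E_i$. Call a probability measure on $\mathbb{R}$ admissible if it has a density with respect to Lebesgue measure and is concentrated on $\{s : |s|<r\}$. Define the mutual-information security metric $$\eta_c=\sup_i\ \sup_{P_S\ \text{admissible}} I(S;Y_i)\in[0,\infty],$$ where the mutual information $I(S;Y_i)$ is computed in bits for $S\sim P_S$ and $Y_i$ with conditional law $P_{Y_i|S=s}$ given $S=s$. Let $D_{\mathrm{TV}}(P,Q)=\sup_A|P(A)-Q(A)|$ (supremum over measurable sets $A$) be the total variation distance. Let $P_S$ be the (admissible) law of the secret $S$, and let $\mathbb{D}_S$ be its topological support. (a) If the map $s\mapsto P_{Y_i|S=s}$ is continuous on $\mathbb{D}_S$ with respect to weak convergence of probability measures for every $i$ (as it is, for instance, when $Y_i=S+N_i$ with noise $N_i$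 independent of $S$), then the distinguishing security metric $$\eta_s=\sup_i\ \sup_{s_1,s_2\in\mathbb{D}_S} D_{\mathrm{TV}}\bigl(P_{Y_i|S=s_1},P_{Y_i|S=s_2}\bigr)$$ satisfies $\eta_s\le\sqrt{2\eta_c}$. (b) With no continuity assumption, the same inequality $\eta_s\le\sqrt{2\eta_c}$ holds when, in the definition of $\eta_s$, the supremum over $(s_1,s_2)$ is replaced by the essential supremum with respect to $P_S\times P_S$. -/

import Mathlib

open MeasureTheory ProbabilityTheory
open scoped ENNReal

noncomputable section

namespace AnalogPrivacy

/-- Total variation distance of two probability measures: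
`sup_A |P A - Q A|` over all measurable sets `A`. -/
def tvDist {α : Type*} [MeasurableSpace α] (P Q : Measure α) : ℝ≥0∞ :=
  ⨆ (A : Set α) (_ : MeasurableSet A), ENNReal.ofReal |P.real A - Q.real A|

/-- Mutual information, in bits, of a pair of random variables with joint law `ρ`: the
Kullback-Leibler divergence (in Mathlib: natural logarithm) of the joint law from the product of
its marginals, divided by `log 2`. It may be infinite. -/
def mutualInfo {α β : Type*} [MeasurableSpace α] [MeasurableSpace β]
    (ρ : Measure (α × β)) : ℝ≥0∞ :=
  InformationTheory.klDiv ρ (ρ.fst.prod ρ.snd) / ENNReal.ofReal (Real.log 2)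

/-- `P` is the law of a continuous random variable `S` (that is, one that has a probability
density with respect to Lebesgue measure) with `|S| < r` almost surely. -/
structure IsSecretLaw (r : ℝ) (P : Measure ℝ) : Prop where
  isProbabilityMeasure : IsProbabilityMeasure P
  absolutelyContinuous : P ≪ volume
  abs_lt : ∀ᵐ s ∂P, |s| < r

section Metrics

variable {ι : Type*} {E : ι → Type*} [∀ i, MeasurableSpace (E i)]

/-- Mutual information security `max_i max_{P_S : |S| < r} I(S; Y_i)`, where `κ i s` is the
conditional law of `Y_i` given `S = s`, so that `P ⊗ₘ κ i` is the joint law of `(S, Y_i)`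
when `S` has law `P`. -/
def mis (r : ℝ) (κ : ∀ i, Kernel ℝ (E i)) : ℝ≥0∞ :=
  ⨆ (i : ι) (P : Measure ℝ) (_ : IsSecretLaw r P), mutualInfo (P.compProd (κ i))

/-- Distinguishing security `max_i max_{s₁, s₂ ∈ D} D_TV(P_{Y_i | S = s₁}, P_{Y_i | S = s₂})`,
where `κ i s` is the conditional law of `Y_i` given `S = s`. -/
def ds (D : Set ℝ) (κ : ∀ i, Kernel ℝ (E i)) : ℝ≥0∞ :=
  ⨆ (i : ι) (s₁ ∈ D) (s₂ ∈ D), tvDist (κ i s₁) (κ i s₂)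

/-- Distinguishing security when the conditional laws are given only up to null sets of values of
the secret: the maximum over pairs `(s₁, s₂)` is an essential supremum for `P × P`, where `P` is
the law of the secret. -/
def essDS (P : Measure ℝ) (κ : ∀ i, Kernel ℝ (E i)) : ℝ≥0∞ :=
  ⨆ i : ι, essSup (fun p : ℝ × ℝ => tvDist (κ i p.1) (κ i p.2)) (P.prod P)

end Metrics

/-- The law `κ s`, as an element of the space of probability measures (whose topology is that of
convergence in distribution). -/
def condLaw {F : Type*} [MeasurableSpace F] (κ : Kernel ℝ F) [IsMarkovKernel κ] (s : ℝ) :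
    ProbabilityMeasure F :=
  ⟨κ s, inferInstance⟩

/-- The law `κ s` depends continuously on `s ∈ D`, for convergence in distribution. -/
def WeaklyContinuousOn {F : Type*} [TopologicalSpace F] [MeasurableSpace F]
    [OpensMeasurableSpace F] (κ : Kernel ℝ F) [IsMarkovKernel κ] (D : Set ℝ) : Prop :=
  ContinuousOn (condLaw κ) D

end AnalogPrivacy

end

namespace AnalogPrivacy

open InformationTheory Real

/-! Restrict the secret to two non-null sets, each with probability 1/2. This law is still
admissible, and the secret now carries a fair sign `σ`. If a test function `f` has means at least
`a` on one set and at most `b` on the other, a Pinsker-type bound gives divergence at least `(a - b)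
^ 2 / 2` (`sub_le_sqrt_of_klDiv_le`). It comes from the variational bound for the divergence with an
exponential test function and Hoeffding's estimate `cosh x ≤ exp (x ^ 2 / 2)`.

For (a), weak continuity makes the means of a continuous `f` nearly constant near two support
points, and relative neighbourhoods of these are non-null; continuous `f` suffice for total
variation. For (b), `f` is the indicator of a set in a countable generating algebra, so only
countably many null sets of pairs are discarded. -/

/-! ### Pinsker-type lower bound for the divergence -/

/-- Fenchel–Young inequality for `klFun`, whose convex conjugate is `fun b ↦ exp b - 1`. -/
lemma mul_sub_exp_add_one_le_klFun {x : ℝ} (hx : 0 ≤ x) (b : ℝ) :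
    x * b - exp b + 1 ≤ klFun x := by
  rw [klFun_apply]
  rcases hx.eq_or_lt with rfl | hx
  · simp [exp_nonneg]
  · have h := add_one_le_exp (b - log x)
    rw [exp_sub, exp_log hx, le_div_iff₀ hx] at h
    linarith

/-- A variational lower bound for the Kullback–Leibler divergence. -/
lemma integral_sub_integral_exp_le_toReal_klDiv {α : Type*} [MeasurableSpace α]
    {ρ μ : Measure α} [IsFiniteMeasure ρ] [IsProbabilityMeasure μ] (h : klDiv ρ μ ≠ ∞)
    {φ : α → ℝ} (hφ : Integrable φ ρ) (hexp : Integrable (fun x ↦ exp (φ x)) μ) :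
    ∫ x, φ x ∂ρ - ∫ x, exp (φ x) ∂μ + 1 ≤ (klDiv ρ μ).toReal := by
  obtain ⟨hac, hint⟩ := klDiv_ne_top_iff.mp h
  have hφ' : Integrable (fun x ↦ (ρ.rnDeriv μ x).toReal * φ x) μ := by
    simpa [smul_eq_mul] using (integrable_rnDeriv_smul_iff hac).mpr hφ
  have hφ_eq : ∫ x, (ρ.rnDeriv μ x).toReal * φ x ∂μ = ∫ x, φ x ∂ρ := by
    simpa [smul_eq_mul] using integral_rnDeriv_smul (f := φ) hac
  have hsub : Integrable (fun x ↦ (ρ.rnDeriv μ x).toReal * φ x - exp (φ x)) μ := hφ'.sub hexp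
  rw [toReal_klDiv_eq_integral_klFun hac, ← hφ_eq]
  calc _ = ∫ x, ((ρ.rnDeriv μ x).toReal * φ x - exp (φ x) + 1) ∂μ := by
        rw [integral_add hsub (integrable_const _), integral_sub hφ' hexp]
        simp
    _ ≤ _ := integral_mono (hsub.add (integrable_const _))
        ((integrable_klFun_rnDeriv_iff hac).mpr hint)
        fun x ↦ mul_sub_exp_add_one_le_klFun ENNReal.toReal_nonneg _

lemma exp_sign_mul (σ x : ℝ) (hσ : σ = 1 ∨ σ = -1) :
    exp (σ * x) = cosh x + σ * sinh x := by
  rcases hσ with rfl | rfl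
  · simp [cosh_add_sinh]
  · rw [neg_one_mul, neg_one_mul, ← sub_eq_add_neg, cosh_sub_sinh]

/-- If a test function with values in `[0, 1]` distinguishes the two values of a balanced sign
`σ` of the secret, then the divergence of the joint law from the product of its marginals is
bounded below, as in Pinsker's inequality. -/
lemma sq_div_two_le_toReal_klDiv_compProd {F : Type*} [MeasurableSpace F]
    {κ : Kernel ℝ F} [IsMarkovKernel κ] {P : Measure ℝ} [IsProbabilityMeasure P]
    (h : klDiv (P.compProd κ) ((P.compProd κ).fst.prod (P.compProd κ).snd) ≠ ∞)
    {f : F → ℝ} (hf : Measurable f) (hf01 : ∀ y, f y ∈ Set.Icc (0 : ℝ) 1)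
    {σ : ℝ → ℝ} (hσ : Measurable σ) (hσ1 : ∀ s, σ s = 1 ∨ σ s = -1) (hσ0 : ∫ s, σ s ∂P = 0)
    {δ : ℝ} (hδ : 0 ≤ δ) (hδ' : δ ≤ 2 * ∫ s, σ s * ∫ y, f y ∂κ s ∂P) :
    δ ^ 2 / 2 ≤
      (klDiv (P.compProd κ) ((P.compProd κ).fst.prod (P.compProd κ).snd)).toReal := by
  set ρ := P.compProd κ with hρ
  have hσle : ∀ s, |σ s| ≤ 1 := fun s ↦ by rcases hσ1 s with h | h <;> simp [h]
  have hgle : ∀ y, |2 * f y - 1| ≤ 1 := fun y ↦ by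
    have := hf01 y
    rw [abs_le]; constructor <;> linarith [this.1, this.2]
  have hfst : ρ.fst = P := Measure.fst_compProd P κ
  rw [hfst] at h ⊢
  have : IsProbabilityMeasure ρ.snd := inferInstance
  -- The shift `δ ^ 2 / 2` normalises the exponential: its integral against the product of marginals
  -- is at most 1.
  set φ : ℝ × F → ℝ := fun p ↦ σ p.1 * (δ * (2 * f p.2 - 1)) - δ ^ 2 / 2 with hφdef
  have hφm : Measurable φ := by fun_prop
  have hψle : ∀ p : ℝ × F, |σ p.1 * (δ * (2 * f p.2 - 1))| ≤ δ := fun p ↦ by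
    rw [abs_mul, abs_mul, abs_of_nonneg hδ]
    calc _ ≤ 1 * (δ * 1) := by
          gcongr
          exacts [hσle _, hgle _]
      _ = δ := by ring
  have hψ : Integrable (fun p : ℝ × F ↦ σ p.1 * (δ * (2 * f p.2 - 1))) ρ :=
    .of_bound (by fun_prop) δ (.of_forall hψle)
  have hexp : Integrable (fun p ↦ exp (φ p)) (P.prod ρ.snd) := by
    refine .of_bound (by fun_prop) (exp δ) (.of_forall fun p ↦ ?_)
    rw [norm_of_nonneg (exp_nonneg _), exp_le_exp]
    have := (le_abs_self _).trans (hψle p)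
    simp only [hφdef]; nlinarith
  have hkl := integral_sub_integral_exp_le_toReal_klDiv h
    (hψ.sub (integrable_const (δ ^ 2 / 2))) hexp
  have hfint : ∀ s, Integrable f (κ s) := fun s ↦
    .of_bound hf.aestronglyMeasurable 1 (.of_forall fun y ↦ by
      rw [norm_of_nonneg (hf01 y).1]; exact (hf01 y).2)
  have hσint : Integrable σ P := .of_bound hσ.aestronglyMeasurable 1 (.of_forall hσle)
  have hFm : StronglyMeasurable fun s ↦ ∫ y, f y ∂κ s := hf.stronglyMeasurable.integral_kernel
  have hσFint : Integrable (fun s ↦ σ s * ∫ y, f y ∂κ s) P := by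
    refine .of_bound (hσ.aestronglyMeasurable.mul hFm.aestronglyMeasurable) 1
      (.of_forall fun s ↦ ?_)
    have h0 : 0 ≤ ∫ y, f y ∂κ s := integral_nonneg fun y ↦ (hf01 y).1
    have h1 : ∫ y, f y ∂κ s ≤ 1 := by
      simpa using integral_mono (hfint s) (integrable_const 1) fun y ↦ (hf01 y).2
    rw [norm_mul, norm_of_nonneg h0]
    exact mul_le_one₀ (hσle s) h0 h1
  have h1 : δ ^ 2 - δ ^ 2 / 2 ≤
      ∫ p, (σ p.1 * (δ * (2 * f p.2 - 1)) - δ ^ 2 / 2) ∂ρ := by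
    rw [integral_sub hψ (integrable_const _), hρ, Measure.integral_compProd hψ]
    have : ∀ s, ∫ y, σ s * (δ * (2 * f y - 1)) ∂κ s
        = 2 * δ * (σ s * ∫ y, f y ∂κ s) - δ * σ s := fun s ↦ by
      rw [integral_const_mul, integral_const_mul,
        integral_sub ((hfint s).const_mul 2) (integrable_const _), integral_const_mul]
      simp; ring
    simp_rw [this]
    rw [integral_sub (hσFint.const_mul _) (hσint.const_mul _), integral_const_mul,
      integral_const_mul, hσ0]
    simp
    nlinarith
  -- Under the product law `σ` is independent of `Y` and has mean 0, so the `sinh` term vanishes and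
  -- only `cosh` remains.
  have h2 : ∫ p, exp (φ p) ∂(P.prod ρ.snd) ≤ 1 := by
    have hcm : Measurable fun y ↦ cosh (δ * (2 * f y - 1)) :=
      continuous_cosh.measurable.comp (by fun_prop)
    have hsm : Measurable fun y ↦ sinh (δ * (2 * f y - 1)) :=
      continuous_sinh.measurable.comp (by fun_prop)
    have hcle : ∀ y, cosh (δ * (2 * f y - 1)) ≤ exp (δ ^ 2 / 2) := fun y ↦ by
      refine (cosh_le_exp_half_sq _).trans (exp_le_exp.mpr ?_)
      have := sq_le_one_iff_abs_le_one _ |>.mpr (hgle y)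
      rw [mul_pow]; nlinarith [sq_nonneg δ]
    have hcint : Integrable (fun y ↦ cosh (δ * (2 * f y - 1))) ρ.snd :=
      .of_bound hcm.aestronglyMeasurable (exp (δ ^ 2 / 2)) (.of_forall fun y ↦ by
        rw [norm_of_nonneg (cosh_pos _).le]; exact hcle y)
    have hsint : Integrable (fun y ↦ sinh (δ * (2 * f y - 1))) ρ.snd := by
      refine hcint.mono' hsm.aestronglyMeasurable (.of_forall fun y ↦ ?_)
      rw [norm_eq_abs, abs_sinh, ← cosh_abs (δ * (2 * f y - 1))]
      exact (sinh_lt_cosh _).le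
    have hcint' : Integrable (fun p : ℝ × F ↦ cosh (δ * (2 * f p.2 - 1))) (P.prod ρ.snd) :=
      hcint.comp_snd P
    have hsint' : Integrable (fun p : ℝ × F ↦ σ p.1 * sinh (δ * (2 * f p.2 - 1)))
        (P.prod ρ.snd) := hσint.mul_prod hsint
    simp_rw [hφdef, exp_sub, exp_sign_mul _ _ (hσ1 _)]
    rw [integral_div, div_le_one (exp_pos _), integral_add hcint' hsint',
      integral_prod_mul σ fun y ↦ sinh (δ * (2 * f y - 1)), hσ0, zero_mul, add_zero,
      integral_fun_snd fun y ↦ cosh (δ * (2 * f y - 1))]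
    simpa using integral_mono hcint (integrable_const (exp (δ ^ 2 / 2))) hcle
  simp only [hφdef, Pi.sub_apply] at hkl h2
  linarith

/-! ### Secrets concentrated on two sets -/

/-- The secret law that is an equal mixture of `P` conditioned on `U₁` and on `U₂`. -/
noncomputable def twoPiece (P : Measure ℝ) (U₁ U₂ : Set ℝ) : Measure ℝ :=
  (2⁻¹ : ℝ≥0∞) • P[|U₁] + (2⁻¹ : ℝ≥0∞) • P[|U₂]

lemma IsSecretLaw.twoPiece {r : ℝ} {P : Measure ℝ} (hP : IsSecretLaw r P) {U₁ U₂ : Set ℝ}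
    (h₁ : P U₁ ≠ 0) (h₂ : P U₂ ≠ 0) : IsSecretLaw r (twoPiece P U₁ U₂) := by
  have := hP.isProbabilityMeasure
  have := cond_isProbabilityMeasure h₁
  have := cond_isProbabilityMeasure h₂
  have hac : AnalogPrivacy.twoPiece P U₁ U₂ ≪ P := by
    intro s hs
    simp [AnalogPrivacy.twoPiece, (cond_absolutelyContinuous (μ := P) (s := U₁)) hs,
      (cond_absolutelyContinuous (μ := P) (s := U₂)) hs]
  exact ⟨⟨by simp [AnalogPrivacy.twoPiece, ENNReal.inv_two_add_inv_two]⟩,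
    hac.trans hP.absolutelyContinuous, hac.ae_le hP.abs_lt⟩

/-- If the divergences of all joint laws are at most `m`, then the means of a test function with
values in `[0, 1]` cannot be separated, on two non-null sets of secrets, by more than
`√(2 m)`. -/
lemma sub_le_sqrt_of_klDiv_le {F : Type*} [MeasurableSpace F]
    {κ : Kernel ℝ F} [IsMarkovKernel κ] {r : ℝ} {P : Measure ℝ} (hP : IsSecretLaw r P)
    {m : ℝ≥0∞} (hm : m ≠ ∞)
    (hκ : ∀ P', IsSecretLaw r P' →
      klDiv (P'.compProd κ) ((P'.compProd κ).fst.prod (P'.compProd κ).snd) ≤ m)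
    {f : F → ℝ} (hf : Measurable f) (hf01 : ∀ y, f y ∈ Set.Icc (0 : ℝ) 1)
    {U₁ U₂ : Set ℝ} (hU₁ : MeasurableSet U₁) (hU₂ : MeasurableSet U₂)
    (h₁ : P U₁ ≠ 0) (h₂ : P U₂ ≠ 0) {a b : ℝ}
    (ha : ∀ s ∈ U₁, a ≤ ∫ y, f y ∂κ s) (hb : ∀ s ∈ U₂, ∫ y, f y ∂κ s ≤ b) :
    a - b ≤ √(2 * m.toReal) := by
  rcases le_or_gt a b with hab | hab
  · exact (sub_nonpos.mpr hab).trans (sqrt_nonneg _)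
  have := hP.isProbabilityMeasure
  have hP' := hP.twoPiece h₁ h₂
  set P' := twoPiece P U₁ U₂ with hP'def
  have := hP'.isProbabilityMeasure
  have hdisj : U₂ ∩ U₁ = ∅ := Set.eq_empty_of_forall_notMem fun s hs ↦ by
    linarith [ha s hs.2, hb s hs.1]
  have hPU₁ : P' U₁ = 2⁻¹ := by
    simp [hP'def, twoPiece, cond_apply hU₂, cond_apply_self h₁ (measure_ne_top _ _), hdisj]
  have hmem : ∀ᵐ s ∂P', s ∈ U₁ ∨ s ∈ U₂ := by
    rw [hP'def, twoPiece, ae_add_measure_iff]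
    exact ⟨Measure.ae_smul_measure ((ae_cond_mem hU₁).mono fun _ ↦ .inl) _,
      Measure.ae_smul_measure ((ae_cond_mem hU₂).mono fun _ ↦ .inr) _⟩
  set σ : ℝ → ℝ := fun s ↦ U₁.indicator (fun _ ↦ 2) s - 1 with hσdef
  have hσm : Measurable σ := (measurable_const.indicator hU₁).sub_const _
  have hσ1 : ∀ s, σ s = 1 ∨ σ s = -1 := fun s ↦ by
    by_cases hs : s ∈ U₁
    · left; simp [hσdef, hs]; norm_num
    · right; simp [hσdef, hs]
  have hσle : ∀ s, |σ s| ≤ 1 := fun s ↦ by rcases hσ1 s with h | h <;> simp [h]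
  have hσint : Integrable σ P' := .of_bound hσm.aestronglyMeasurable 1 (.of_forall hσle)
  have hσ0 : ∫ s, σ s ∂P' = 0 := by
    rw [integral_sub ((integrable_const _).indicator hU₁) (integrable_const _),
      integral_indicator_const _ hU₁, measureReal_def, hPU₁]
    simp
  have hfint : ∀ s, Integrable f (κ s) := fun s ↦
    .of_bound hf.aestronglyMeasurable 1 (.of_forall fun y ↦ by
      rw [norm_of_nonneg (hf01 y).1]; exact (hf01 y).2)
  have hFm : StronglyMeasurable fun s ↦ ∫ y, f y ∂κ s := hf.stronglyMeasurable.integral_kernel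
  have hσFint : Integrable (fun s ↦ σ s * ∫ y, f y ∂κ s) P' := by
    refine .of_bound (hσm.aestronglyMeasurable.mul hFm.aestronglyMeasurable) 1
      (.of_forall fun s ↦ ?_)
    have h0 : 0 ≤ ∫ y, f y ∂κ s := integral_nonneg fun y ↦ (hf01 y).1
    have h1 : ∫ y, f y ∂κ s ≤ 1 := by
      simpa using integral_mono (hfint s) (integrable_const 1) fun y ↦ (hf01 y).2
    rw [norm_mul, norm_of_nonneg h0]
    exact mul_le_one₀ (hσle s) h0 h1
  have hlow : a - b ≤ 2 * ∫ s, σ s * ∫ y, f y ∂κ s ∂P' := by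
    -- The affine function of `σ` equal to `a` at `σ = 1` and to `-b` at `σ = -1`.
    have hle : ∫ s, ((a - b) / 2 + σ s * ((a + b) / 2)) ∂P' ≤ ∫ s, σ s * ∫ y, f y ∂κ s ∂P' := by
      refine integral_mono_ae ((integrable_const _).add (hσint.mul_const _)) hσFint ?_
      filter_upwards [hmem] with s hs
      by_cases hs₁ : s ∈ U₁
      · have : σ s = 1 := by simp [hσdef, hs₁]; norm_num
        rw [this]; linarith [ha s hs₁]
      · have : σ s = -1 := by simp [hσdef, hs₁]
        rw [this]; linarith [hb s (hs.resolve_left hs₁)]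
    rw [integral_add (integrable_const _) (hσint.mul_const _), integral_mul_const, hσ0] at hle
    simp at hle
    linarith
  have hle := sq_div_two_le_toReal_klDiv_compProd (ne_top_of_le_ne_top hm (hκ P' hP')) hf hf01
    hσm hσ1 hσ0 (sub_pos.mpr hab).le hlow
  refine le_sqrt_of_sq_le ?_
  linarith [ENNReal.toReal_mono hm (hκ P' hP')]

/-! ### From test functions to total variation -/

/-- Two real functions that are never separated by more than `c` on two non-null sets differ by
at most `c` on almost every pair. -/
lemma ae_sub_le_of_forall_sub_le {α : Type*} [MeasurableSpace α] {P : Measure α} [SFinite P]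
    {g : α → ℝ} {c : ℝ}
    (h : ∀ (a b : ℝ), P {s | a ≤ g s} ≠ 0 → P {s | g s ≤ b} ≠ 0 → a - b ≤ c) :
    ∀ᵐ p ∂(P.prod P), g p.1 - g p.2 ≤ c := by
  -- Rational thresholds reduce the exceptional set to countably many null rectangles.
  have key : ∀ᵐ p ∂(P.prod P), ∀ a b : ℚ, c < a - b → ¬ ((a : ℝ) ≤ g p.1 ∧ g p.2 ≤ b) := by
    simp_rw [ae_all_iff]
    intro a b hab
    have h0 : (P.prod P) ({s | (a : ℝ) ≤ g s} ×ˢ {s | g s ≤ b}) = 0 := by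
      rw [Measure.prod_prod, mul_eq_zero]
      by_contra! hne
      exact hab.not_ge (h a b hne.1 hne.2)
    simp_rw [ae_iff, not_not]
    exact h0
  filter_upwards [key] with p hp
  by_contra! hlt
  obtain ⟨b, hb1, hb2⟩ := exists_rat_btwn (show g p.2 < g p.1 - c by linarith)
  obtain ⟨a, ha1, ha2⟩ := exists_rat_btwn (show b + c < g p.1 by linarith)
  exact hp a b (by linarith) ⟨ha2.le, hb1.le⟩

/-- Passing to complements reverses the sign of the difference, so one-sided bounds suffice. -/
lemma tvDist_le_ofReal {α : Type*} [MeasurableSpace α] {P Q : Measure α}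
    [IsProbabilityMeasure P] [IsProbabilityMeasure Q] {c : ℝ}
    (h : ∀ A, MeasurableSet A → P.real A - Q.real A ≤ c) : tvDist P Q ≤ ENNReal.ofReal c := by
  refine iSup₂_le fun A hA ↦ ENNReal.ofReal_le_ofReal (abs_le'.mpr ⟨h A hA, ?_⟩)
  have := h Aᶜ hA.compl
  rw [probReal_compl_eq_one_sub hA, probReal_compl_eq_one_sub hA] at this
  linarith

/-- Approximation in `P + Q` controls the error for both measures at once. -/
lemma measureReal_sub_le_of_forall_mem_setAlgebra {α : Type*} [m : MeasurableSpace α]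
    {P Q : Measure α} [IsFiniteMeasure P] [IsFiniteMeasure Q] {𝒜 : Set (Set α)}
    (h𝒜 : IsSetAlgebra 𝒜) (hgen : m = MeasurableSpace.generateFrom 𝒜) {c : ℝ}
    (h : ∀ A ∈ 𝒜, P.real A - Q.real A ≤ c) {A : Set α} (hA : MeasurableSet A) :
    P.real A - Q.real A ≤ c := by
  refine le_of_forall_pos_le_add fun ε hε ↦ ?_
  obtain ⟨t, ht, htA⟩ := exists_measure_symmDiff_lt_of_generateFrom_isSetRing (μ := P + Q)
    h𝒜.isSetRing ⟨{Set.univ}, Set.countable_singleton _, by simpa using h𝒜.univ_mem, by simp⟩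
    hgen hA (ENNReal.ofReal_pos.mpr hε)
  have htm : MeasurableSet t := hgen ▸ MeasurableSpace.measurableSet_generateFrom ht
  have hsum : P.real (symmDiff t A) + Q.real (symmDiff t A) < ε := by
    rw [← measureReal_add_apply, measureReal_def]
    exact (ENNReal.lt_ofReal_iff_toReal_lt (measure_ne_top _ _)).mp htA
  have hPA : P.real A ≤ P.real t + P.real (symmDiff t A) :=
    (measureReal_mono fun x hx ↦ by by_cases x ∈ t <;> simp_all [Set.mem_symmDiff]).trans
      (measureReal_union_le _ _)
  have hQA : Q.real t ≤ Q.real A + Q.real (symmDiff t A) :=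
    (measureReal_mono fun x hx ↦ by by_cases x ∈ A <;> simp_all [Set.mem_symmDiff]).trans
      (measureReal_union_le _ _)
  linarith [h t ht]

/-- Inner regularity replaces `A` by a closed subset, whose indicator is a limit of continuous
thickened indicators. -/
lemma measureReal_sub_le_of_forall_continuous {α : Type*} [PseudoEMetricSpace α]
    [MeasurableSpace α] [BorelSpace α] {P Q : Measure α} [IsFiniteMeasure P] [IsFiniteMeasure Q]
    {c : ℝ} (h : ∀ f : α → ℝ, Continuous f → (∀ y, f y ∈ Set.Icc (0 : ℝ) 1) →
      ∫ y, f y ∂P - ∫ y, f y ∂Q ≤ c) {A : Set α} (hA : MeasurableSet A) :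
    P.real A - Q.real A ≤ c := by
  refine le_of_forall_pos_le_add fun ε hε ↦ ?_
  obtain ⟨K, hKA, hK, hlt⟩ := hA.exists_isClosed_lt_add (measure_ne_top P A)
    (ENNReal.ofReal_pos.mpr hε).ne'
  have hPK : P.real A ≤ P.real K + ε := by
    have := ENNReal.toReal_mono (by simp) hlt.le
    rwa [ENNReal.toReal_add (measure_ne_top _ _) ENNReal.ofReal_ne_top,
      ENNReal.toReal_ofReal hε.le] at this
  have hδ : ∀ n : ℕ, (0 : ℝ) < 1 / (n + 1) := fun n ↦ Nat.one_div_pos_of_nat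
  have hlim (μ : Measure α) [IsFiniteMeasure μ] := tendsto_integral_thickenedIndicator_of_isClosed μ
    hK hδ tendsto_one_div_add_atTop_nhds_zero_nat
  have hKle : P.real K - Q.real K ≤ c :=
    le_of_tendsto ((hlim P).sub (hlim Q)) <| .of_forall fun n ↦ h _
      (NNReal.continuous_coe.comp (thickenedIndicator (hδ n) K).continuous)
      fun y ↦ ⟨NNReal.coe_nonneg _, by exact_mod_cast thickenedIndicator_le_one (hδ n) K y⟩
  linarith [measureReal_mono (μ := Q) hKA]

end AnalogPrivacy

/-! ### The two security inequalities -/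

open AnalogPrivacy InformationTheory in
theorem mainTheorem3 {ι : Type*} {E : ι → Type*}
    [∀ i, NormedAddCommGroup (E i)] [∀ i, NormedSpace ℝ (E i)] [∀ i, FiniteDimensional ℝ (E i)]
    [∀ i, MeasurableSpace (E i)] [∀ i, BorelSpace (E i)]
    (r : ℝ) (κ : ∀ i, Kernel ℝ (E i)) [∀ i, IsMarkovKernel (κ i)]
    (P : Measure ℝ) (hP : AnalogPrivacy.IsSecretLaw r P) :
    ((∀ i, AnalogPrivacy.WeaklyContinuousOn (κ i) P.support) →
        AnalogPrivacy.ds P.support κ ≤ (2 * AnalogPrivacy.mis r κ) ^ (1 / 2 : ℝ)) ∧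
      AnalogPrivacy.essDS P κ ≤ (2 * AnalogPrivacy.mis r κ) ^ (1 / 2 : ℝ) := by
  by_cases hm : mis r κ = ∞
  · simp [hm]
  have := hP.isProbabilityMeasure
  have hrhs : (2 * mis r κ) ^ (1 / 2 : ℝ) = ENNReal.ofReal √(2 * (mis r κ).toReal) := by
    rw [Real.sqrt_eq_rpow, ← ENNReal.ofReal_rpow_of_nonneg (by positivity) (by norm_num),
      ENNReal.ofReal_mul (by norm_num), ENNReal.ofReal_toReal hm, ENNReal.ofReal_ofNat]
  rw [hrhs]
  have hκ : ∀ i P', IsSecretLaw r P' → klDiv (P'.compProd (κ i))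
      ((P'.compProd (κ i)).fst.prod (P'.compProd (κ i)).snd) ≤ mis r κ := fun i P' hP' ↦ by
    have hlog : 0 < Real.log 2 := Real.log_pos (by norm_num)
    have hle : mutualInfo (P'.compProd (κ i)) ≤ mis r κ :=
      le_iSup_of_le i <| le_iSup₂_of_le P' hP' le_rfl
    rw [mutualInfo, ENNReal.div_le_iff (ENNReal.ofReal_pos.mpr hlog).ne' ENNReal.ofReal_ne_top]
      at hle
    -- Passing from bits to nats multiplies by `log 2 < 1`; this factor is simply dropped.
    refine hle.trans (mul_le_of_le_one_right' (ENNReal.ofReal_le_one.mpr ?_))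
    linarith [Real.log_two_lt_d9]
  refine ⟨fun hcont ↦ ?_, ?_⟩
  · refine iSup_le fun i ↦ iSup₂_le fun s₁ hs₁ ↦ iSup₂_le fun s₂ hs₂ ↦ tvDist_le_ofReal fun A hA ↦
      measureReal_sub_le_of_forall_continuous (fun f hf hf01 ↦ ?_) hA
    have hF : ContinuousOn (fun s ↦ ∫ y, f y ∂κ i s) P.support := fun s hs ↦
      ProbabilityMeasure.tendsto_iff_forall_integral_tendsto.mp (hcont i s hs)
        (.ofNormedAddCommGroup f hf 1 fun y ↦ by
          rw [Real.norm_of_nonneg (hf01 y).1]; exact (hf01 y).2)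
    have hFm : Measurable fun s ↦ ∫ y, f y ∂κ i s :=
      (hf.measurable.stronglyMeasurable.integral_kernel (κ := κ i)).measurable
    -- Continuity holds only within the support, so relative neighbourhoods must be non-null; they
    -- are, since the complement of the support is null.
    have hpos : ∀ s ∈ P.support, ∀ V : Set ℝ, V ∈ nhdsWithin s P.support → P V ≠ 0 := by
      intro s hs V hV h0
      obtain ⟨W, hW, hWV⟩ := mem_nhdsWithin_iff_exists_mem_nhds_inter.mp hV
      refine ((Measure.mem_support_iff_forall s).mp hs W hW).ne' ?_
      rw [← measure_inter_add_sdiff₀ W Measure.nullMeasurableSet_support,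
        measure_mono_null hWV h0, zero_add]
      exact measure_mono_null (fun x hx ↦ hx.2) Measure.measure_compl_support
    refine le_of_forall_pos_le_add fun ε hε ↦ ?_
    have hle := sub_le_sqrt_of_klDiv_le hP hm (hκ i) hf.measurable hf01
      (U₁ := {s | ∫ y, f y ∂κ i s₁ - ε / 2 ≤ ∫ y, f y ∂κ i s})
      (U₂ := {s | ∫ y, f y ∂κ i s ≤ ∫ y, f y ∂κ i s₂ + ε / 2})
      (measurableSet_le measurable_const hFm) (measurableSet_le hFm measurable_const)
      (hpos s₁ hs₁ _ ((hF s₁ hs₁).eventually_const_le (by linarith)))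
      (hpos s₂ hs₂ _ ((hF s₂ hs₂).eventually_le_const (by linarith)))
      (fun s hs ↦ hs) (fun s hs ↦ hs)
    linarith
  · refine iSup_le fun i ↦ essSup_le_of_ae_le _ ?_
    set 𝒜 := generateSetAlgebra (MeasurableSpace.countableGeneratingSet (E i)) with h𝒜
    have hgen : ‹∀ i, MeasurableSpace (E i)› i = MeasurableSpace.generateFrom 𝒜 := by
      rw [h𝒜, generateFrom_generateSetAlgebra_eq,
        MeasurableSpace.generateFrom_countableGeneratingSet]
    have hae : ∀ᵐ p ∂(P.prod P), ∀ A ∈ 𝒜,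
        (κ i p.1).real A - (κ i p.2).real A ≤ √(2 * (mis r κ).toReal) := by
      rw [ae_ball_iff (countable_generateSetAlgebra
        MeasurableSpace.countable_countableGeneratingSet)]
      intro A hA
      have hAm : MeasurableSet A := hgen ▸ MeasurableSpace.measurableSet_generateFrom hA
      have hg : Measurable fun s ↦ (κ i s).real A := ((κ i).measurable_coe hAm).ennreal_toReal
      have hint : ∀ s, ∫ y, A.indicator 1 y ∂κ i s = (κ i s).real A := fun s ↦
        integral_indicator_one hAm
      refine ae_sub_le_of_forall_sub_le (P := P) (g := fun s ↦ (κ i s).real A) fun a b ha hb ↦ ?_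
      refine sub_le_sqrt_of_klDiv_le hP hm (hκ i) (f := A.indicator 1)
        (measurable_one.indicator hAm) (fun y ↦ ?_)
        (measurableSet_le measurable_const hg) (measurableSet_le hg measurable_const) ha hb
        (fun s hs ↦ (hint s).symm ▸ hs) (fun s hs ↦ (hint s).symm ▸ hs)
      by_cases hy : y ∈ A <;> simp [hy]
    filter_upwards [hae] with p hp
    exact tvDist_le_ofReal fun A hA ↦
      measureReal_sub_le_of_forall_mem_setAlgebra isSetAlgebra_generateSetAlgebra hgen hp hA
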